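/- Let $x_1,\dots,x_n\in\mathbb{R}^q$ be nonzero vectors that span $\mathbb{R}^q$, let $b>0$ and $a>q/2$ (the concave case). For a positive definite matrix $\Sigma$, the mean-zero elliptical gamma density with scatter matrix $\Sigma$, shape $a$ and scale $b$ is $$p(x;\Sigma,a,b)=\frac{\Gamma(q/2)}{\pi^{q/2}\,\Gamma(a)\,b^a\,|\Sigma|^{1/2}}\,\bigl(x^\top\Sigma^{-1}x\bigr)^{a-q/2}\exp\bigl(-b^{-1}x^\top\Sigma^{-1}x\bigr).$$ Put $$c'=\frac{2(a-q/2)}{n}>0,\qquad B=\frac{2}{bn}\sum_{i=1}^n x_ix_i^\top,\qquad y_i=B^{-1/2}x_i,\qquad Y=[y_1,\dots,y_n],$$ and, for positive definite $S\in\mathbb{R}^{q\times q}$, $$\mathcal{G}(S)=I+c'\,S^{1/2}\,Y D_S Y^\top S^{1/2},\qquad D_S=\operatorname{Diag}\Bigl(\frac{1}{y_1^\top S y_1},\dots,\frac{1}{y_n^\top S y_n}\Bigr).$$ Then $\mathcal{G}$ has exactly one positive definite fixed point $S^*$. For every $\mu>1+c'n$, the order interval $\mathcal{D}=[I,\mu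 I]$ in the Loewner order is compact and contains $S^*$, and for every $S_0\in\mathcal{D}$ the Picard iteration $S_{k+1}=\mathcal{G}(S_k)$ converges to $S^*$. Moreover, $\Sigma^*=B^{1/2}(S^*)^{-1}B^{1/2}$ is the maximum likelihood estimate of the scatter matrix: it is positive definite and it is the unique maximizer of the log-likelihood $\sum_{i=1}^n\log p(x_i;\Sigma,a,b)$ over all positive definite $\Sigma$. -/

import Mathlib

open scoped MatrixOrder

noncomputable section

namespace EllipticalGamma

/-- The mean-zero elliptical gamma density on `ℝ^q` with scatter matrix `Sig`, shape parameter `a`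
and scale parameter `b`, evaluated at the point `x`. -/
def density {q : ℕ} (Sig : Matrix (Fin q) (Fin q) ℝ) (a b : ℝ) (x : Fin q → ℝ) : ℝ :=
  Real.Gamma ((q : ℝ) / 2) /
      (Real.pi ^ ((q : ℝ) / 2) * Real.Gamma a * b ^ a * Sig.det ^ (1 / 2 : ℝ)) *
    (x ⬝ᵥ Sig⁻¹.mulVec x) ^ (a - (q : ℝ) / 2) *
    Real.exp (-(b⁻¹ * (x ⬝ᵥ Sig⁻¹.mulVec x)))

/-- The log-likelihood of the scatter matrix `Sig` for the independent samples `x i`, with the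
shape `a` and the scale `b` given. -/
def logLikelihood {q n : ℕ} (x : Fin n → Fin q → ℝ) (a b : ℝ)
    (Sig : Matrix (Fin q) (Fin q) ℝ) : ℝ :=
  ∑ i, Real.log (density Sig a b (x i))

/-- The constant `c' = -c = 2 (a - q / 2) / n`, which is positive for `a > q / 2`. -/
def cPrime (q n : ℕ) (a : ℝ) : ℝ :=
  2 * (a - (q : ℝ) / 2) / (n : ℝ)

/-- The matrix `B = d ∑ i, x i (x i)ᵀ` with `d = 2 / (b n)`. -/
def matB {q n : ℕ} (x : Fin n → Fin q → ℝ) (b : ℝ) : Matrix (Fin q) (Fin q) ℝ :=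
  (2 / (b * (n : ℝ))) • ∑ i, Matrix.vecMulVec (x i) (x i)

/-- The transformed samples `y i = B^(-1/2) x i`. -/
def transformed {q n : ℕ} (x : Fin n → Fin q → ℝ) (b : ℝ) (i : Fin n) : Fin q → ℝ :=
  (CFC.sqrt (matB x b))⁻¹.mulVec (x i)

/-- The map `G(S) = I + c' S^(1/2) Y D_S Yᵀ S^(1/2)`, where `Y` is the matrix with the columns
`y i` and `D_S` is the diagonal matrix with the entries `1 / ((y i)ᵀ S (y i))`. -/
def mapG {q n : ℕ} (c' : ℝ) (y : Fin n → Fin q → ℝ) (S : Matrix (Fin q) (Fin q) ℝ) :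
    Matrix (Fin q) (Fin q) ℝ :=
  let Y : Matrix (Fin q) (Fin n) ℝ := Matrix.of fun r i => y i r
  let D : Matrix (Fin n) (Fin n) ℝ := Matrix.diagonal fun i => 1 / (y i ⬝ᵥ S.mulVec (y i))
  1 + c' • (CFC.sqrt S * Y * D * Y.transpose * CFC.sqrt S)

/-- The order interval `[I, μ I]` in the Loewner order. -/
def orderInterval (q : ℕ) (μ : ℝ) : Set (Matrix (Fin q) (Fin q) ℝ) :=
  Set.Icc 1 (μ • (1 : Matrix (Fin q) (Fin q) ℝ))

end EllipticalGamma

end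

/-! ### Log-determinant and trace inequalities. -/

namespace EllipticalGamma
open Matrix

variable {m ι : Type*} [Fintype m]

/-! With `R = B^(1/2) Σ⁻¹ B^(1/2)`, the log-likelihood is an affine increasing function of
`objective`, `φ(R) = log det R + c' ∑ log (yᵢᵀ R yᵢ) - tr R` (`exists_logLikelihood_eq`). The
gradient of `φ` at `S`, conjugated by `S^(1/2)`, is `G(S) - S`, so fixed points of `G` are critical
points. The bounds `log det X ≤ tr X - q` and `log r ≤ r - 1` make each fixed point a strict global
maximizer (`objective_lt_of_fixed`), hence unique.

Convergence needs no contraction: `φ` is a strict Lyapunov function (`objective_lt_mapG`). Writing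
`G(S) = S^(1/2) X S^(1/2)` and using `log det X ≥ q - tr X⁻¹` and `log r ≥ 1 - 1/r`, the increase of
`φ` reduces to the trace inequality `trace_inv_add_sum_inv_le`, the core of the proof.

`G` maps positive definite matrices into the compact interval `[I, μI]` and is continuous there.
Cluster points of its orbits exist and are fixed (`fixed_of_mapClusterPt_iterate`). This gives
existence, and with uniqueness it gives convergence. -/

theorem trace_mul_vecMulVec_self (A : Matrix m m ℝ) (u : m → ℝ) :
    (A * vecMulVec u u).trace = u ⬝ᵥ A *ᵥ u := by
  rw [mul_vecMulVec, trace_vecMulVec, dotProduct_comm]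

variable [DecidableEq m]

/-- Sum `log t ≤ t - 1` over the eigenvalues; it is strict at an eigenvalue other than 1, which
exists by the spectral theorem. -/
theorem log_det_lt_trace_sub_card {X : Matrix m m ℝ} (hX : X.PosDef) (h1 : X ≠ 1) :
    Real.log X.det < X.trace - Fintype.card m := by
  obtain ⟨j, hj⟩ : ∃ j, hX.isHermitian.eigenvalues j ≠ 1 := by
    by_contra! h
    refine h1 ?_
    have hs := hX.isHermitian.spectral_theorem
    have h2 : (RCLike.ofReal ∘ hX.isHermitian.eigenvalues : m → ℝ) = 1 := by
      funext i; simp [h i]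
    rw [h2] at hs
    rw [hs]
    simp [Unitary.conjStarAlgAut_apply]
  rw [hX.isHermitian.det_eq_prod_eigenvalues, hX.isHermitian.trace_eq_sum_eigenvalues]
  simp only [RCLike.ofReal_real_eq_id, id_eq]
  rw [Real.log_prod fun i _ => (hX.eigenvalues_pos i).ne']
  calc _ < ∑ i, (hX.isHermitian.eigenvalues i - 1) :=
        Finset.sum_lt_sum (fun i _ => Real.log_le_sub_one_of_pos (hX.eigenvalues_pos i))
          ⟨j, Finset.mem_univ j, Real.log_lt_sub_one_of_pos (hX.eigenvalues_pos j) hj⟩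
    _ = _ := by simp

theorem card_sub_trace_inv_lt_log_det {X : Matrix m m ℝ} (hX : X.PosDef) (h1 : X ≠ 1) :
    Fintype.card m - X⁻¹.trace < Real.log X.det := by
  have h2 : X⁻¹ ≠ 1 := fun h => h1 (by
    rw [← nonsing_inv_nonsing_inv X ((isUnit_iff_isUnit_det X).1 hX.isUnit), h, inv_one])
  have := log_det_lt_trace_sub_card hX.inv h2
  rw [det_nonsing_inv, Ring.inverse_eq_inv', Real.log_inv] at this
  linarith

/-- The trace is the squared Frobenius norm of `P^(1/2) Q P^(1/2)`. -/
theorem trace_mul_mul_mul_transpose_nonneg {P : Matrix m m ℝ} (hP : P.PosSemidef)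
    (Q : Matrix m m ℝ) : 0 ≤ (P * Q * P * Qᵀ).trace := by
  have h := CFC.sqrt_mul_sqrt_self P hP.nonneg
  have hR : (CFC.sqrt P)ᵀ = CFC.sqrt P := by
    simpa using (nonneg_iff_posSemidef.1 (CFC.sqrt_nonneg P)).isHermitian.eq
  set R := CFC.sqrt P
  have h3 : (P * Q * P * Qᵀ).trace = ((R * Q * R) * (R * Q * R)ᵀ).trace := by
    rw [← h]
    simp only [transpose_mul, hR]
    simp only [Matrix.mul_assoc]
    rw [Matrix.trace_mul_comm]
    simp only [Matrix.mul_assoc]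
  rw [h3]
  simpa using (posSemidef_self_mul_conjTranspose (R * Q * R)).trace_nonneg

end EllipticalGamma

/-! ### The trace inequality behind the ascent property. -/

namespace EllipticalGamma
open Matrix

variable {m ι : Type*} [Fintype m] [DecidableEq m] [Fintype ι]

/-- An operator Cauchy-Schwarz inequality: the weights `X⁻¹` on `I` and `hᵢ` on `vᵢvᵢᵀ` have first
moment `Φ` and total mass `G`, so the second moment dominates `Φ G⁻¹ Φ`. Pairing with `X` turns the
second moment into the right-hand side, since `hᵢ² (vᵢᵀ X vᵢ) = hᵢ`. -/
theorem trace_mul_mul_le_of_frame {X G Φ : Matrix m m ℝ} {c : ℝ} {v : ι → m → ℝ} {h : ι → ℝ}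
    (hX : X.PosDef) (hG : G.PosDef) (hc : 0 ≤ c)
    (hGv : G = 1 + c • ∑ i, vecMulVec (v i) (v i))
    (hΦ : Φ = X⁻¹ + c • ∑ i, h i • vecMulVec (v i) (v i))
    (hh : ∀ i, h i * (v i ⬝ᵥ X *ᵥ v i) = 1) :
    (X * (Φ * G⁻¹ * Φ)).trace ≤ X⁻¹.trace + c * ∑ i, h i := by
  have uX : IsUnit X.det := (isUnit_iff_isUnit_det X).1 hX.isUnit
  have uG : IsUnit G.det := (isUnit_iff_isUnit_det G).1 hG.isUnit
  have sX : X⁻¹ᵀ = X⁻¹ := by simpa using hX.inv.isHermitian.eq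
  have sG : G⁻¹ᵀ = G⁻¹ := by simpa using hG.inv.isHermitian.eq
  have sΦ : Φᵀ = Φ := by
    rw [hΦ, transpose_add, transpose_smul, transpose_sum, sX]
    simp [transpose_vecMulVec]
  set C := G⁻¹ * Φ with hC
  have hCt : Cᵀ = Φ * G⁻¹ := by rw [hC, transpose_mul, sΦ, sG]
  -- Completing the square: `C = G⁻¹ Φ` is the mean of the weights, and `Cᵀ Φ`, `Φ C`, `Cᵀ G C` all
  -- equal `Φ G⁻¹ Φ`.
  have hexp : (X⁻¹ - Cᵀ) * (X⁻¹ - C) +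
      c • ∑ i, (h i • 1 - Cᵀ) * vecMulVec (v i) (v i) * (h i • 1 - C) =
      X⁻¹ * X⁻¹ + c • ∑ i, (h i ^ 2) • vecMulVec (v i) (v i) - Φ * G⁻¹ * Φ := by
    have h1 : c • ∑ i, (h i • 1 - Cᵀ) * vecMulVec (v i) (v i) * (h i • 1 - C) =
        c • ∑ i, (h i ^ 2) • vecMulVec (v i) (v i)
          - Cᵀ * (c • ∑ i, h i • vecMulVec (v i) (v i))
          - (c • ∑ i, h i • vecMulVec (v i) (v i)) * C
          + Cᵀ * (c • ∑ i, vecMulVec (v i) (v i)) * C := by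
      simp only [mul_smul_comm, smul_mul_assoc, Finset.mul_sum, Finset.sum_mul]
      rw [← smul_sub, ← smul_sub, ← smul_add, ← Finset.sum_sub_distrib, ← Finset.sum_sub_distrib,
        ← Finset.sum_add_distrib]
      congr 1
      refine Finset.sum_congr rfl fun i _ => ?_
      simp only [sub_mul, mul_sub, smul_mul_assoc, mul_smul_comm, one_mul, mul_one, smul_sub,
        pow_two, ← smul_smul]
      abel
    have h2 : c • ∑ i, h i • vecMulVec (v i) (v i) = Φ - X⁻¹ := by rw [hΦ]; abel
    have h3 : c • ∑ i, vecMulVec (v i) (v i) = G - 1 := by rw [hGv]; abel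
    rw [h1, h2, h3]
    have e1 : Cᵀ * Φ = Φ * G⁻¹ * Φ := by rw [hCt]
    have e2 : Φ * C = Φ * G⁻¹ * Φ := by rw [hC, Matrix.mul_assoc]
    have e3 : Cᵀ * G * C = Φ * G⁻¹ * Φ := by
      rw [hCt, Matrix.mul_assoc Φ, nonsing_inv_mul _ uG, Matrix.mul_one, e2]
    simp only [sub_mul, mul_sub, mul_one, e1, e2, e3]
    abel
  have t1 : 0 ≤ (X * ((X⁻¹ - Cᵀ) * (X⁻¹ - C))).trace := by
    rw [← Matrix.mul_assoc, Matrix.trace_mul_comm, ← Matrix.mul_assoc]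
    have := (hX.posSemidef.mul_mul_conjTranspose_same (X⁻¹ - C)).trace_nonneg
    simpa [transpose_sub, sX] using this
  have t2 : ∀ i, 0 ≤ (X * ((h i • 1 - Cᵀ) * vecMulVec (v i) (v i) * (h i • 1 - C))).trace := by
    intro i
    have := hX.posSemidef.dotProduct_mulVec_nonneg ((h i • 1 - Cᵀ) *ᵥ v i)
    rw [star_trivial, ← trace_mul_vecMulVec_self] at this
    rw [mul_vecMulVec, vecMulVec_mul]
    have e : v i ᵥ* (h i • 1 - C) = (h i • 1 - Cᵀ) *ᵥ v i := by
      rw [← mulVec_transpose]; simp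
    rwa [e]
  have t3 : (X * (X⁻¹ * X⁻¹)).trace = X⁻¹.trace := by
    rw [← Matrix.mul_assoc, mul_nonsing_inv _ uX, Matrix.one_mul]
  have t4 : (X * (c • ∑ i, (h i ^ 2) • vecMulVec (v i) (v i))).trace = c * ∑ i, h i := by
    simp only [mul_smul_comm, Finset.mul_sum, trace_smul, trace_sum, trace_mul_vecMulVec_self,
      smul_eq_mul]
    refine Finset.sum_congr rfl fun i _ => ?_
    rw [pow_two, mul_assoc (h i), hh, mul_one]
  have t5 : 0 ≤ (X * ((X⁻¹ - Cᵀ) * (X⁻¹ - C) +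
      c • ∑ i, (h i • 1 - Cᵀ) * vecMulVec (v i) (v i) * (h i • 1 - C))).trace := by
    rw [Matrix.mul_add, trace_add, mul_smul_comm, trace_smul, Finset.mul_sum, trace_sum]
    exact add_nonneg t1 (mul_nonneg hc (Finset.sum_nonneg fun i _ => t2 i))
  rw [hexp, Matrix.mul_sub, Matrix.mul_add, trace_sub, trace_add, t3, t4] at t5
  linarith

/-- A noncommutative form of `∑ g² / r = ∑ s` for `r = g² / s`: the left-hand side is evaluated along
a rank-one decomposition of `G`, which can only decrease it. -/
theorem trace_inv_add_sum_inv_le {T X G : Matrix m m ℝ} {c : ℝ} {v : ι → m → ℝ}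
    (hT : T.PosDef) (hG : G.PosDef) (hc : 0 ≤ c) (hX : X = T⁻¹ * G * T⁻¹)
    (hGv : G = 1 + c • ∑ i, vecMulVec (v i) (v i)) (hv : ∀ i, v i ⬝ᵥ v i = 1) :
    X⁻¹.trace + c * ∑ i, (v i ⬝ᵥ X *ᵥ v i)⁻¹ ≤ (T * T).trace := by
  have uT : IsUnit T.det := (isUnit_iff_isUnit_det T).1 hT.isUnit
  have uG : IsUnit G.det := (isUnit_iff_isUnit_det G).1 hG.isUnit
  have sR : T⁻¹ᵀ = T⁻¹ := by simpa using hT.inv.isHermitian.eq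
  have sT : Tᵀ = T := by simpa using hT.isHermitian.eq
  have sG : Gᵀ = G := by simpa using hG.isHermitian.eq
  have pX : X.PosDef := by
    have := (IsUnit.posDef_star_right_conjugate_iff hT.inv.isUnit (x := G)).2 hG
    rw [star_eq_conjTranspose, conjTranspose_eq_transpose_of_trivial, sR] at this
    rwa [hX]
  have sX : X⁻¹ᵀ = X⁻¹ := by simpa using pX.inv.isHermitian.eq
  have hpos : ∀ i, 0 < v i ⬝ᵥ X *ᵥ v i := by
    intro i
    have h0 : v i ≠ 0 := by
      intro h; have := hv i; simp [h] at this
    simpa using pX.dotProduct_mulVec_pos h0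
  -- The trace of `Φ` is the left-hand side of the goal because the `vᵢ` are unit vectors.
  obtain ⟨Φ, hΦ⟩ : ∃ Φ, Φ = X⁻¹ + c • ∑ i, (v i ⬝ᵥ X *ᵥ v i)⁻¹ • vecMulVec (v i) (v i) := ⟨_, rfl⟩
  have sΦ : Φᵀ = Φ := by
    rw [hΦ, transpose_add, transpose_smul, transpose_sum, sX]
    simp [transpose_vecMulVec]
  have trΦ : Φ.trace = X⁻¹.trace + c * ∑ i, (v i ⬝ᵥ X *ᵥ v i)⁻¹ := by
    rw [hΦ]
    simp [trace_sum, trace_vecMulVec, hv]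
  have ha := trace_mul_mul_le_of_frame pX hG hc hGv hΦ fun i => inv_mul_cancel₀ (hpos i).ne'
  rw [← trΦ] at ha ⊢
  have gi : G⁻¹ * G = 1 := nonsing_inv_mul _ uG
  have gi' : G * G⁻¹ = 1 := mul_nonsing_inv _ uG
  have ti : T⁻¹ * T = 1 := nonsing_inv_mul _ uT
  have ti' : T * T⁻¹ = 1 := mul_nonsing_inv _ uT
  generalize hR : T⁻¹ = R at *
  generalize hP : G⁻¹ = P at *
  -- The commutator-like matrix `Φ R G - G R Φ` has nonnegative squared norm in the metric given by
  -- `P = G⁻¹`; it measures the failure of commutativity.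
  have hb : 0 ≤ 2 * (X * (Φ * P * Φ)).trace - 2 * (R * Φ * R * Φ).trace := by
    have h0 := trace_mul_mul_mul_transpose_nonneg (hP ▸ hG.inv.posSemidef)
      (Φ * R * G - G * R * Φ)
    have e1 : P * (Φ * R * G - G * R * Φ) * P = P * Φ * R - R * Φ * P := by
      calc _ = P * Φ * R * (G * P) - (P * G) * R * Φ * P := by noncomm_ring
        _ = _ := by rw [gi, gi']; noncomm_ring
    have e2 : (Φ * R * G - G * R * Φ)ᵀ = G * R * Φ - Φ * R * G := by
      simp only [transpose_sub, transpose_mul, sΦ, sR, sG, Matrix.mul_assoc]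
    have e3 : (P * Φ * R - R * Φ * P) * (G * R * Φ - Φ * R * G) =
        P * (Φ * R * G * R * Φ) - P * (Φ * R * Φ * R * G) - R * Φ * (P * G) * R * Φ
          + R * Φ * P * Φ * R * G := by noncomm_ring
    have f1 : (P * (Φ * R * G * R * Φ)).trace = (X * (Φ * P * Φ)).trace := by
      rw [hX, Matrix.trace_mul_comm, show Φ * R * G * R * Φ * P = Φ * (R * G * R * Φ * P) by
        noncomm_ring, Matrix.trace_mul_comm]
      congr 1; noncomm_ring
    have f2 : (P * (Φ * R * Φ * R * G)).trace = (R * Φ * R * Φ).trace := by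
      rw [Matrix.trace_mul_comm, Matrix.mul_assoc _ G P, gi', Matrix.mul_one,
        show Φ * R * Φ * R = Φ * (R * Φ * R) by noncomm_ring, Matrix.trace_mul_comm]
    have f3 : (R * Φ * P * Φ * R * G).trace = (X * (Φ * P * Φ)).trace := by
      rw [hX, show R * Φ * P * Φ * R * G = R * (Φ * P * Φ) * (R * G) by noncomm_ring,
        Matrix.trace_mul_comm]
      congr 1; noncomm_ring
    rw [e1, e2, e3, trace_add, trace_sub, trace_sub, f1, f2, f3, gi, Matrix.mul_one] at h0
    linarith
  -- The squared norm of `T² - Φ` in the metric given by `R = T⁻¹`.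
  have hc' : 0 ≤ (T * T).trace - 2 * Φ.trace + (R * Φ * R * Φ).trace := by
    have h0 := trace_mul_mul_mul_transpose_nonneg (hR ▸ hT.inv.posSemidef) (T * T - Φ)
    have e1 : (T * T - Φ)ᵀ = T * T - Φ := by
      simp only [transpose_sub, transpose_mul, sΦ, sT]
    have e2 : R * (T * T - Φ) * R * (T * T - Φ) =
        (R * T) * (T * R) * T * T - (R * T) * (T * R) * Φ - R * (Φ * (R * T) * T)
          + R * Φ * R * Φ := by noncomm_ring
    rw [e1, e2, ti, ti', trace_add, trace_sub, trace_sub, Matrix.trace_mul_comm R,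
      show Φ * 1 * T * R = Φ * (T * R) by noncomm_ring, ti'] at h0
    simp only [Matrix.one_mul, Matrix.mul_one] at h0
    linarith
  -- The chain is `tr T² ≥ 2 tr Φ - tr (RΦRΦ) ≥ 2 tr Φ - tr (XΦPΦ) ≥ tr Φ`.
  linarith

end EllipticalGamma

/-! ### The map `mapG`, the objective, and strict ascent. -/

namespace EllipticalGamma
open Matrix

theorem posDef_sqrt {m : Type*} [Fintype m] [DecidableEq m] {S : Matrix m m ℝ} (hS : S.PosDef) :
    (CFC.sqrt S).PosDef := by
  refine (PosSemidef.posDef_iff_isUnit (nonneg_iff_posSemidef.1 (CFC.sqrt_nonneg S))).2 ?_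
  have h : CFC.sqrt S * CFC.sqrt S = S := CFC.sqrt_mul_sqrt_self S hS.posSemidef.nonneg
  have h2 := hS.isUnit
  rw [isUnit_iff_isUnit_det] at h2 ⊢
  rw [← h, det_mul] at h2
  exact isUnit_of_mul_isUnit_left h2

theorem transpose_sqrt {m : Type*} [Fintype m] [DecidableEq m] (S : Matrix m m ℝ) :
    (CFC.sqrt S)ᵀ = CFC.sqrt S := by
  simpa using (nonneg_iff_posSemidef.1 (CFC.sqrt_nonneg S)).isHermitian.eq

theorem sqrt_mul_sqrt {m : Type*} [Fintype m] [DecidableEq m] {S : Matrix m m ℝ} (hS : S.PosDef) :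
    CFC.sqrt S * CFC.sqrt S = S :=
  CFC.sqrt_mul_sqrt_self S hS.posSemidef.nonneg

theorem posDef_conj {m : Type*} [Fintype m] [DecidableEq m] {T R : Matrix m m ℝ}
    (hT : T.PosDef) (hR : R.PosDef) : (T * R * T).PosDef := by
  have := (IsUnit.posDef_star_right_conjugate_iff hT.isUnit (x := R)).2 hR
  rwa [star_eq_conjTranspose, hT.isHermitian.eq] at this

variable {q n : ℕ}

theorem mapG_eq (c : ℝ) (y : Fin n → Fin q → ℝ) (S : Matrix (Fin q) (Fin q) ℝ) :
    mapG c y S = 1 + c • ∑ i, (y i ⬝ᵥ S *ᵥ y i)⁻¹ •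
      vecMulVec (CFC.sqrt S *ᵥ y i) (CFC.sqrt S *ᵥ y i) := by
  have h : ∀ d : Fin n → ℝ, (of fun r i => y i r : Matrix (Fin q) (Fin n) ℝ) * diagonal d *
      (of fun r i => y i r : Matrix (Fin q) (Fin n) ℝ)ᵀ = ∑ i, d i • vecMulVec (y i) (y i) := by
    intro d
    ext r s
    rw [mul_apply, Matrix.sum_apply]
    refine Finset.sum_congr rfl fun i _ => ?_
    rw [mul_diagonal, of_apply, transpose_apply, of_apply, Matrix.smul_apply, vecMulVec_apply,
      smul_eq_mul]
    ring
  simp only [mapG, one_div]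
  rw [Matrix.mul_assoc (CFC.sqrt S), Matrix.mul_assoc (CFC.sqrt S), h]
  simp only [Finset.mul_sum, Finset.sum_mul, mul_smul_comm, smul_mul_assoc]
  congr 2
  refine Finset.sum_congr rfl fun i _ => ?_
  rw [mul_vecMulVec, vecMulVec_mul, ← mulVec_transpose, transpose_sqrt]

/-- The image of `S` under `mapG` is the identity plus a weighted sum of rank-one projections, and
the projections describe the quadratic forms of the samples in the coordinates given by `S`. -/
theorem exists_unit_vectors (c : ℝ) {y : Fin n → Fin q → ℝ} (hy : ∀ i, y i ≠ 0)
    {S : Matrix (Fin q) (Fin q) ℝ} (hS : S.PosDef) :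
    ∃ v : Fin n → Fin q → ℝ, (∀ i, v i ⬝ᵥ v i = 1) ∧
      mapG c y S = 1 + c • ∑ i, vecMulVec (v i) (v i) ∧
      ∀ X i, y i ⬝ᵥ (CFC.sqrt S * X * CFC.sqrt S) *ᵥ y i =
        (y i ⬝ᵥ S *ᵥ y i) * (v i ⬝ᵥ X *ᵥ v i) := by
  have hd : ∀ i, 0 < y i ⬝ᵥ S *ᵥ y i := fun i => by simpa using hS.dotProduct_mulVec_pos (hy i)
  have hc : ∀ X i, y i ⬝ᵥ (CFC.sqrt S * X * CFC.sqrt S) *ᵥ y i =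
      (CFC.sqrt S *ᵥ y i) ⬝ᵥ X *ᵥ (CFC.sqrt S *ᵥ y i) := by
    intro X i
    rw [← mulVec_mulVec, ← mulVec_mulVec, dotProduct_mulVec, ← mulVec_transpose, transpose_sqrt]
  have hs : ∀ i, (√(y i ⬝ᵥ S *ᵥ y i))⁻¹ * (√(y i ⬝ᵥ S *ᵥ y i))⁻¹ = (y i ⬝ᵥ S *ᵥ y i)⁻¹ := by
    intro i
    rw [← mul_inv, Real.mul_self_sqrt (hd i).le]
  refine ⟨fun i => (√(y i ⬝ᵥ S *ᵥ y i))⁻¹ • (CFC.sqrt S *ᵥ y i), fun i => ?_, ?_, fun X i => ?_⟩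
  · have := hc 1 i
    rw [Matrix.mul_one, sqrt_mul_sqrt hS, one_mulVec] at this
    rw [smul_dotProduct, dotProduct_smul, ← this, smul_eq_mul, smul_eq_mul, ← mul_assoc, hs,
      inv_mul_cancel₀ (hd i).ne']
  · rw [mapG_eq]
    congr 2
    refine Finset.sum_congr rfl fun i _ => ?_
    rw [smul_vecMulVec, vecMulVec_smul, smul_smul, hs]
  · rw [hc, mulVec_smul, smul_dotProduct, dotProduct_smul, smul_eq_mul, smul_eq_mul,
      ← mul_assoc (_)⁻¹, hs, mul_inv_cancel_left₀ (hd i).ne']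

/-- The log-likelihood in the transformed variable, up to a positive factor and a constant. -/
noncomputable def objective (c : ℝ) (y : Fin n → Fin q → ℝ) (S : Matrix (Fin q) (Fin q) ℝ) : ℝ :=
  Real.log S.det + c * ∑ i, Real.log (y i ⬝ᵥ S *ᵥ y i) - S.trace

/-- Determinants and the sample quadratic forms factor under conjugation by `S^(1/2)`, so in the
increment all dependence on `S` outside the traces cancels. -/
theorem objective_conj_sub (c : ℝ) {y v : Fin n → Fin q → ℝ} (hy : ∀ i, y i ≠ 0)
    {S X : Matrix (Fin q) (Fin q) ℝ} (hS : S.PosDef) (hX : X.PosDef) (hv : ∀ i, v i ⬝ᵥ v i = 1)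
    (h : ∀ X i, y i ⬝ᵥ (CFC.sqrt S * X * CFC.sqrt S) *ᵥ y i =
        (y i ⬝ᵥ S *ᵥ y i) * (v i ⬝ᵥ X *ᵥ v i)) :
    objective c y (CFC.sqrt S * X * CFC.sqrt S) - objective c y S =
      Real.log X.det + c * ∑ i, Real.log (v i ⬝ᵥ X *ᵥ v i)
        - (CFC.sqrt S * X * CFC.sqrt S).trace + S.trace := by
  have hd : ∀ i, 0 < y i ⬝ᵥ S *ᵥ y i := fun i => by simpa using hS.dotProduct_mulVec_pos (hy i)
  have hr : ∀ i, 0 < v i ⬝ᵥ X *ᵥ v i := by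
    intro i
    have h0 : v i ≠ 0 := by
      intro h; have := hv i; simp [h] at this
    simpa using hX.dotProduct_mulVec_pos h0
  have hdet : Real.log (CFC.sqrt S * X * CFC.sqrt S).det = Real.log S.det + Real.log X.det := by
    rw [det_mul, det_mul, mul_right_comm, ← det_mul, sqrt_mul_sqrt hS,
      Real.log_mul hS.det_pos.ne' hX.det_pos.ne']
  unfold objective
  simp only [h]
  simp only [Real.log_mul (hd _).ne' (hr _).ne', Finset.sum_add_distrib, mul_add]
  rw [hdet]
  ring

theorem posDef_one_add_sum_vecMulVec {c : ℝ} (hc : 0 ≤ c) (v : Fin n → Fin q → ℝ) :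
    (1 + c • ∑ i, vecMulVec (v i) (v i)).PosDef :=
  PosDef.one.add_posSemidef ((posSemidef_sum _ fun i _ => by
    simpa using posSemidef_vecMulVec_self_star (v i)).smul hc)

theorem posDef_mapG {c : ℝ} (hc : 0 ≤ c) {y : Fin n → Fin q → ℝ} (hy : ∀ i, y i ≠ 0)
    {S : Matrix (Fin q) (Fin q) ℝ} (hS : S.PosDef) : (mapG c y S).PosDef := by
  obtain ⟨v, -, hG, -⟩ := exists_unit_vectors c hy hS
  rw [hG]
  exact posDef_one_add_sum_vecMulVec hc v

theorem conj_sqrt_inv {S R : Matrix (Fin q) (Fin q) ℝ} (hS : S.PosDef) :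
    CFC.sqrt S * ((CFC.sqrt S)⁻¹ * R * (CFC.sqrt S)⁻¹) * CFC.sqrt S = R := by
  have hu := (isUnit_iff_isUnit_det _).1 (posDef_sqrt hS).isUnit
  calc _ = (CFC.sqrt S * (CFC.sqrt S)⁻¹) * R * ((CFC.sqrt S)⁻¹ * CFC.sqrt S) := by
        simp only [Matrix.mul_assoc]
    _ = R := by rw [mul_nonsing_inv _ hu, nonsing_inv_mul _ hu, Matrix.one_mul, Matrix.mul_one]

theorem conj_inv_ne_one {S R : Matrix (Fin q) (Fin q) ℝ} (hS : S.PosDef) (h : R ≠ S) :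
    (CFC.sqrt S)⁻¹ * R * (CFC.sqrt S)⁻¹ ≠ 1 := by
  intro h1
  have := conj_sqrt_inv (R := R) hS
  rw [h1, Matrix.mul_one, sqrt_mul_sqrt hS] at this
  exact h this.symm

/-- A fixed point of `mapG` is the strict global maximizer of the objective. -/
theorem objective_lt_of_fixed {c : ℝ} (hc : 0 ≤ c) {y : Fin n → Fin q → ℝ} (hy : ∀ i, y i ≠ 0)
    {S R : Matrix (Fin q) (Fin q) ℝ} (hS : S.PosDef) (hfix : mapG c y S = S) (hR : R.PosDef)
    (hne : R ≠ S) : objective c y R < objective c y S := by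
  obtain ⟨v, hv, hG, hq⟩ := exists_unit_vectors c hy hS
  rw [hfix] at hG
  obtain ⟨X, hXdef⟩ : ∃ X, X = (CFC.sqrt S)⁻¹ * R * (CFC.sqrt S)⁻¹ := ⟨_, rfl⟩
  have hX : X.PosDef := hXdef ▸ posDef_conj (posDef_sqrt hS).inv hR
  have hXR : CFC.sqrt S * X * CFC.sqrt S = R := hXdef ▸ conj_sqrt_inv hS
  have hX1 : X ≠ 1 := hXdef ▸ conj_inv_ne_one hS hne
  have hdiff := objective_conj_sub c hy hS hX hv hq
  have hlog := log_det_lt_trace_sub_card hX hX1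
  have hsum : ∑ i, Real.log (v i ⬝ᵥ X *ᵥ v i) ≤ ∑ i, (v i ⬝ᵥ X *ᵥ v i - 1) := by
    refine Finset.sum_le_sum fun i _ => Real.log_le_sub_one_of_pos ?_
    have h0 : v i ≠ 0 := by
      intro h; have := hv i; simp [h] at this
    simpa using hX.dotProduct_mulVec_pos h0
  -- By the fixed-point equation, the linear upper bounds on the logarithms add up exactly to `tr R
  -- - tr S`.
  have htr : (X * S).trace = X.trace + c * ∑ i, v i ⬝ᵥ X *ᵥ v i := by
    conv_lhs => rw [hG]
    rw [Matrix.mul_add, Matrix.mul_one, mul_smul_comm, Finset.mul_sum, trace_add, trace_smul,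
      trace_sum]
    simp [trace_mul_vecMulVec_self]
  have htrR : R.trace = (X * S).trace := by
    rw [← hXR, Matrix.mul_assoc, Matrix.trace_mul_comm, Matrix.mul_assoc, sqrt_mul_sqrt hS]
  have htrS : S.trace = q + c * n := by
    rw [hG, trace_add, trace_smul, trace_sum]
    simp [trace_vecMulVec, hv]
  have := mul_le_mul_of_nonneg_left hsum hc
  rw [hXR] at hdiff
  simp only [Finset.sum_sub_distrib, Finset.sum_const, Finset.card_univ, Fintype.card_fin,
    nsmul_eq_mul, mul_one, mul_sub] at this hlog
  linarith

/-- The map `mapG` strictly increases the objective away from its fixed points. -/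
theorem objective_lt_mapG {c : ℝ} (hc : 0 ≤ c) {y : Fin n → Fin q → ℝ} (hy : ∀ i, y i ≠ 0)
    {S : Matrix (Fin q) (Fin q) ℝ} (hS : S.PosDef) (hne : mapG c y S ≠ S) :
    objective c y S < objective c y (mapG c y S) := by
  obtain ⟨v, hv, hG, hq⟩ := exists_unit_vectors c hy hS
  have hGpos := posDef_mapG hc hy hS
  obtain ⟨G, hGdef⟩ : ∃ G, G = mapG c y S := ⟨_, rfl⟩
  rw [← hGdef] at hG hGpos hne ⊢
  obtain ⟨X, hXdef⟩ : ∃ X, X = (CFC.sqrt S)⁻¹ * G * (CFC.sqrt S)⁻¹ := ⟨_, rfl⟩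
  have hX : X.PosDef := hXdef ▸ posDef_conj (posDef_sqrt hS).inv hGpos
  have hXR : CFC.sqrt S * X * CFC.sqrt S = G := hXdef ▸ conj_sqrt_inv hS
  have hX1 : X ≠ 1 := hXdef ▸ conj_inv_ne_one hS hne
  have hdiff := objective_conj_sub c hy hS hX hv hq
  have hlog := card_sub_trace_inv_lt_log_det hX hX1
  have hsum : ∑ i, (1 - (v i ⬝ᵥ X *ᵥ v i)⁻¹) ≤ ∑ i, Real.log (v i ⬝ᵥ X *ᵥ v i) := by
    refine Finset.sum_le_sum fun i _ => Real.one_sub_inv_le_log_of_pos ?_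
    have h0 : v i ≠ 0 := by
      intro h; have := hv i; simp [h] at this
    simpa using hX.dotProduct_mulVec_pos h0
  have htrG : G.trace = q + c * n := by
    rw [hG, trace_add, trace_smul, trace_sum]
    simp [trace_vecMulVec, hv]
  -- The constants `q + c n` from the logarithmic bounds cancel `tr G`; what remains is this
  -- inequality with `T = S^(1/2)`.
  have hmain := trace_inv_add_sum_inv_le (posDef_sqrt hS) hGpos hc hXdef hG hv
  rw [sqrt_mul_sqrt hS] at hmain
  have := mul_le_mul_of_nonneg_left hsum hc
  rw [hXR] at hdiff
  simp only [Finset.sum_sub_distrib, Finset.sum_const, Finset.card_univ, Fintype.card_fin,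
    nsmul_eq_mul, mul_one, mul_sub] at this hlog
  linarith

end EllipticalGamma

/-! ### Compactness and continuity on the order interval, and convergence. -/

namespace EllipticalGamma
open Matrix Filter Topology

theorem eq_of_mapClusterPt_of_tendsto {α X : Type*} [TopologicalSpace X] [T2Space X] {F : Filter α}
    {u : α → X} {a b : X} (ha : MapClusterPt a F u) (hb : Tendsto u F (𝓝 b)) : a = b := by
  have : (𝓝 a ⊓ 𝓝 b).NeBot := ha.clusterPt.mono hb
  exact eq_of_nhds_neBot this

/-- If a continuous self-map of a compact space strictly increases a continuous function away from
its fixed points, then every cluster point of its orbits is a fixed point. -/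
theorem fixed_of_mapClusterPt_iterate {α : Type*} [TopologicalSpace α] [CompactSpace α]
    {g : α → α} {φ : α → ℝ} (hg : Continuous g) (hφ : Continuous φ)
    (hlt : ∀ s, g s ≠ s → φ s < φ (g s)) {s p : α}
    (hp : MapClusterPt p atTop fun k : ℕ => g^[k] s) : g p = p := by
  have hmono : Monotone fun k : ℕ => φ (g^[k] s) := by
    refine monotone_nat_of_le_succ fun k => ?_
    rw [Function.iterate_succ_apply']
    by_cases h : g (g^[k] s) = g^[k] s
    · rw [h]
    · exact (hlt _ h).le
  have hbdd : BddAbove (Set.range fun k : ℕ => φ (g^[k] s)) :=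
    (isCompact_range hφ).bddAbove.mono (by rintro _ ⟨k, rfl⟩; exact ⟨_, rfl⟩)
  -- At a cluster point `p`, both `φ p` and `φ (g p)` equal this limit, the second through the
  -- shifted sequence; strict ascent then forces `g p = p`.
  have hlim := tendsto_atTop_ciSup hmono hbdd
  have h1 := eq_of_mapClusterPt_of_tendsto (hp.continuousAt_comp hφ.continuousAt) hlim
  have hlim' := hlim.comp (tendsto_add_atTop_nat 1)
  have h2 := eq_of_mapClusterPt_of_tendsto
    (hp.continuousAt_comp (f := fun t => φ (g t)) (hφ.comp hg).continuousAt)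
    (hlim'.congr fun k => by simp only [Function.comp_apply, Function.iterate_succ_apply'])
  by_contra h
  exact (hlt p h).ne (h1.trans h2.symm)

variable {q n : ℕ}

theorem isClosed_posSemidef : IsClosed {A : Matrix (Fin q) (Fin q) ℝ | A.PosSemidef} := by
  have h : {A : Matrix (Fin q) (Fin q) ℝ | A.PosSemidef} =
      {A | Aᵀ = A} ∩ ⋂ x : Fin q → ℝ, {A | 0 ≤ x ⬝ᵥ A *ᵥ x} := by
    ext A
    simp only [Set.mem_ofPred_eq, Set.mem_inter_iff, Set.mem_iInter]
    rw [posSemidef_iff_dotProduct_mulVec, IsHermitian, conjTranspose_eq_transpose_of_trivial]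
    simp
  rw [h]
  refine (isClosed_eq (by fun_prop) (by fun_prop)).inter (isClosed_iInter fun x => ?_)
  exact isClosed_le continuous_const
    (continuous_const.dotProduct (continuous_id.matrix_mulVec continuous_const))

theorem isCompact_entries (r : ℝ) :
    IsCompact {A : Matrix (Fin q) (Fin q) ℝ | ∀ i j, A i j ∈ Set.Icc (-r) r} := by
  have h := isCompact_univ_pi fun _ : Fin q =>
    isCompact_univ_pi fun _ : Fin q => isCompact_Icc (a := -r) (b := r)
  have e : {A : Fin q → Fin q → ℝ | ∀ i j, A i j ∈ Set.Icc (-r) r} =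
      Set.univ.pi fun _ => Set.univ.pi fun _ => Set.Icc (-r) r := by
    ext A
    simp only [Set.mem_ofPred_eq, Set.mem_pi, Set.mem_univ, true_imp_iff]
  exact e ▸ h

theorem diag_le_of_le_smul_one {μ : ℝ} {A : Matrix (Fin q) (Fin q) ℝ}
    (h : A ≤ μ • (1 : Matrix (Fin q) (Fin q) ℝ)) (i : Fin q) : A i i ≤ μ := by
  have := (Matrix.le_iff.1 h).diag_nonneg (i := i)
  simpa using this

theorem sqrt_entries {μ : ℝ} {S : Matrix (Fin q) (Fin q) ℝ} (hS : S.PosDef)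
    (h : S ≤ μ • (1 : Matrix (Fin q) (Fin q) ℝ)) (i j : Fin q) :
    CFC.sqrt S i j ∈ Set.Icc (-√μ) (√μ) := by
  -- Each row of the symmetric root has squared norm equal to a diagonal entry of `S`.
  have h1 : ∑ k, CFC.sqrt S i k ^ 2 = S i i := by
    conv_rhs => rw [← sqrt_mul_sqrt hS, mul_apply]
    refine Finset.sum_congr rfl fun k _ => ?_
    have := congrFun (congrFun (transpose_sqrt S) i) k
    rw [transpose_apply] at this
    rw [this, pow_two]
  have h2 : CFC.sqrt S i j ^ 2 ≤ S i i := h1 ▸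
    Finset.single_le_sum (f := fun k => CFC.sqrt S i k ^ 2) (fun k _ => sq_nonneg _)
      (Finset.mem_univ j)
  exact abs_le.1 (Real.abs_le_sqrt (h2.trans (diag_le_of_le_smul_one h i)))

theorem posDef_of_mem_orderInterval {μ : ℝ} {S : Matrix (Fin q) (Fin q) ℝ}
    (h : S ∈ orderInterval q μ) : S.PosDef := by
  have := PosDef.one.add_posSemidef (Matrix.le_iff.1 h.1)
  rwa [add_sub_cancel] at this

theorem isCompact_orderInterval (μ : ℝ) : IsCompact (orderInterval q μ) := by
  have hclosed : IsClosed (orderInterval q μ) := by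
    have h : orderInterval q μ = (fun A => A - 1) ⁻¹' {A | A.PosSemidef} ∩
        (fun A => μ • (1 : Matrix (Fin q) (Fin q) ℝ) - A) ⁻¹' {A | A.PosSemidef} := rfl
    rw [h]
    exact (isClosed_posSemidef.preimage (by fun_prop)).inter
      (isClosed_posSemidef.preimage (by fun_prop))
  refine (isCompact_entries μ).of_isClosed_subset hclosed fun S hS i j => ?_
  have hpd := (posDef_of_mem_orderInterval hS).posSemidef
  have hi := diag_le_of_le_smul_one hS.2 i
  have hj := diag_le_of_le_smul_one hS.2 j
  have hsymm : S j i = S i j := by simpa using hpd.isHermitian.apply i j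
  -- Testing on `eᵢ ± eⱼ` gives `2 |Sᵢⱼ| ≤ Sᵢᵢ + Sⱼⱼ ≤ 2μ`.
  have hp := hpd.dotProduct_mulVec_nonneg (Pi.single i 1 + Pi.single j 1)
  have hm := hpd.dotProduct_mulVec_nonneg (Pi.single i 1 - Pi.single j 1)
  simp only [star_trivial, mulVec_add, mulVec_sub, add_dotProduct, sub_dotProduct, dotProduct_add,
    dotProduct_sub, single_one_dotProduct, mulVec_single_one, col_apply, hsymm] at hp hm
  constructor <;> linarith

/-- The roots stay in a compact set, and every cluster point as `A → S` is a positive semidefinite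
root of `S`; such a root is unique. -/
theorem continuousOn_sqrt_orderInterval (μ : ℝ) :
    ContinuousOn (CFC.sqrt : Matrix (Fin q) (Fin q) ℝ → _) (orderInterval q μ) := by
  intro S hS
  have hmem : ∀ᶠ A in 𝓝[orderInterval q μ] S, A ∈ orderInterval q μ := self_mem_nhdsWithin
  refine (isCompact_entries (√μ)).tendsto_nhds_of_unique_mapClusterPt
    (hmem.mono fun A hA => sqrt_entries (posDef_of_mem_orderInterval hA) hA.2) fun T _ hT => ?_
  have hpsd : T.PosSemidef := isClosed_posSemidef.mem_of_mapClusterPt hT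
    (Eventually.of_forall fun A => nonneg_iff_posSemidef.1 (CFC.sqrt_nonneg A))
  have hsq : T * T = S := by
    refine eq_of_mapClusterPt_of_tendsto
      (hT.continuousAt_comp (f := fun A => A * A) (by fun_prop)) ?_
    refine (tendsto_id.mono_left nhdsWithin_le_nhds).congr' (hmem.mono fun A hA => ?_)
    exact (sqrt_mul_sqrt (posDef_of_mem_orderInterval hA)).symm
  exact (CFC.sqrt_unique hsq hpsd.nonneg).symm

theorem continuousOn_mapG (c μ : ℝ) {y : Fin n → Fin q → ℝ} (hy : ∀ i, y i ≠ 0) :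
    ContinuousOn (mapG c y) (orderInterval q μ) := by
  have hs := continuousOn_iff_continuous_domRestrict.1 (continuousOn_sqrt_orderInterval (q := q) μ)
  rw [continuousOn_iff_continuous_domRestrict]
  have h : (orderInterval q μ).domRestrict (mapG c y) = fun S => 1 + c • ∑ i,
      (y i ⬝ᵥ S.1 *ᵥ y i)⁻¹ • vecMulVec (CFC.sqrt S.1 *ᵥ y i) (CFC.sqrt S.1 *ᵥ y i) := by
    funext S
    exact mapG_eq c y S.1
  rw [h]
  refine continuous_const.add ((continuous_finsetSum _ fun i _ => ?_).const_smul c)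
  have hT : Continuous fun S : orderInterval q μ => CFC.sqrt S.1 *ᵥ y i :=
    Continuous.matrix_mulVec hs continuous_const
  have hr : Continuous fun S : orderInterval q μ => (y i ⬝ᵥ S.1 *ᵥ y i)⁻¹ := by
    refine (continuous_const.dotProduct
      (continuous_subtype_val.matrix_mulVec continuous_const)).inv₀ fun S => ?_
    have := (posDef_of_mem_orderInterval S.2).dotProduct_mulVec_pos (hy i)
    rw [star_trivial] at this
    exact this.ne'
  exact hr.smul (hT.matrix_vecMulVec hT)

theorem continuousOn_objective (c μ : ℝ) {y : Fin n → Fin q → ℝ} (hy : ∀ i, y i ≠ 0) :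
    ContinuousOn (objective c y) (orderInterval q μ) := by
  rw [continuousOn_iff_continuous_domRestrict]
  change Continuous fun S : orderInterval q μ =>
    Real.log S.1.det + c * ∑ i, Real.log (y i ⬝ᵥ S.1 *ᵥ y i) - S.1.trace
  refine Continuous.sub (Continuous.add (Continuous.log continuous_subtype_val.matrix_det
    fun S => (posDef_of_mem_orderInterval S.2).det_pos.ne')
    (continuous_const.mul (continuous_finsetSum _ fun i _ => Continuous.log
      (continuous_const.dotProduct (continuous_subtype_val.matrix_mulVec continuous_const))
      fun S => ?_))) continuous_subtype_val.matrix_trace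
  have := (posDef_of_mem_orderInterval S.2).dotProduct_mulVec_pos (hy i)
  rw [star_trivial] at this
  exact this.ne'

/-- The matrix is an orthogonal projection, so it is its own Gram matrix. -/
theorem posSemidef_one_sub_vecMulVec {v : Fin q → ℝ} (hv : v ⬝ᵥ v = 1) :
    (1 - vecMulVec v v).PosSemidef := by
  have h : 1 - vecMulVec v v = (1 - vecMulVec v v)ᴴ * (1 - vecMulVec v v) := by
    rw [conjTranspose_eq_transpose_of_trivial, transpose_sub, transpose_one, transpose_vecMulVec,
      sub_mul, mul_sub, mul_sub, vecMulVec_mul_vecMulVec, hv]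
    simp
  rw [h]
  exact posSemidef_conjTranspose_mul_self _

/-- Each of the `n` projections lies between 0 and `I`. As `S` may be any positive definite matrix,
every positive definite fixed point lies in the interval. -/
theorem mapG_mem_orderInterval {c μ : ℝ} (hc : 0 ≤ c) (hμ : 1 + c * n ≤ μ)
    {y : Fin n → Fin q → ℝ} (hy : ∀ i, y i ≠ 0) {S : Matrix (Fin q) (Fin q) ℝ} (hS : S.PosDef) :
    mapG c y S ∈ orderInterval q μ := by
  obtain ⟨v, hv, hG, -⟩ := exists_unit_vectors c hy hS
  rw [hG]
  constructor
  · rw [Matrix.le_iff, add_sub_cancel_left]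
    exact (posSemidef_sum _ fun i _ => by
      simpa using posSemidef_vecMulVec_self_star (v i)).smul hc
  · rw [Matrix.le_iff]
    have h : μ • (1 : Matrix (Fin q) (Fin q) ℝ) - (1 + c • ∑ i, vecMulVec (v i) (v i)) =
        (μ - (1 + c * n)) • 1 + c • ∑ i, (1 - vecMulVec (v i) (v i)) := by
      rw [Finset.sum_sub_distrib, Finset.sum_const, Finset.card_univ, Fintype.card_fin, smul_sub,
        ← Nat.cast_smul_eq_nsmul ℝ, smul_smul, sub_smul, add_smul, one_smul]
      abel
    rw [h]
    exact (PosSemidef.one.smul (sub_nonneg.2 hμ)).add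
      ((posSemidef_sum _ fun i _ => posSemidef_one_sub_vecMulVec (hv i)).smul hc)

/-- The Picard iteration of `mapG` on an order interval: it has fixed points as cluster points. -/
theorem exists_restricted_mapG {c μ : ℝ} (hc : 0 ≤ c) (hμ : 1 + c * n ≤ μ)
    {y : Fin n → Fin q → ℝ} (hy : ∀ i, y i ≠ 0) :
    ∃ g : orderInterval q μ → orderInterval q μ,
      (∀ (k : ℕ) S, ((g^[k] S : orderInterval q μ) : Matrix (Fin q) (Fin q) ℝ) =
        (mapG c y)^[k] S.1) ∧
      ∀ S P, MapClusterPt P atTop (fun k : ℕ => g^[k] S) → mapG c y P.1 = P.1 := by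
  have := isCompact_iff_compactSpace.1 (isCompact_orderInterval (q := q) μ)
  have hmaps : Set.MapsTo (mapG c y) (orderInterval q μ) (orderInterval q μ) := fun S hS =>
    mapG_mem_orderInterval hc hμ hy (posDef_of_mem_orderInterval hS)
  refine ⟨hmaps.restrict, fun k S => ?_, fun S P hP => ?_⟩
  · rw [hmaps.iterate_restrict]
    rfl
  · have h := fixed_of_mapClusterPt_iterate (g := hmaps.restrict)
      (φ := (orderInterval q μ).domRestrict (objective c y))
      ((continuousOn_mapG c μ hy).mapsToRestrict hmaps)
      (continuousOn_iff_continuous_domRestrict.1 (continuousOn_objective c μ hy))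
      (fun S hne => objective_lt_mapG hc hy (posDef_of_mem_orderInterval S.2)
        fun h => hne (Subtype.ext h)) hP
    exact congrArg Subtype.val h

theorem exists_fixed_mapG {c : ℝ} (hc : 0 ≤ c) {y : Fin n → Fin q → ℝ} (hy : ∀ i, y i ≠ 0) :
    ∃ S : Matrix (Fin q) (Fin q) ℝ, S.PosDef ∧ mapG c y S = S := by
  obtain ⟨g, -, hg⟩ := exists_restricted_mapG hc le_rfl hy
  have := isCompact_iff_compactSpace.1 (isCompact_orderInterval (q := q) (1 + c * n))
  obtain ⟨P, -, hP⟩ := isCompact_univ.exists_mapClusterPt (f := atTop)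
    (u := fun k : ℕ => g^[k] ⟨_, mapG_mem_orderInterval hc le_rfl hy PosDef.one⟩) (by simp)
  exact ⟨P.1, posDef_of_mem_orderInterval P.2, hg _ P hP⟩

theorem eq_of_fixed_mapG {c : ℝ} (hc : 0 ≤ c) {y : Fin n → Fin q → ℝ} (hy : ∀ i, y i ≠ 0)
    {S T : Matrix (Fin q) (Fin q) ℝ} (hS : S.PosDef) (hfS : mapG c y S = S)
    (hT : T.PosDef) (hfT : mapG c y T = T) : T = S := by
  by_contra h
  exact lt_asymm (objective_lt_of_fixed hc hy hS hfS hT h)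
    (objective_lt_of_fixed hc hy hT hfT hS (Ne.symm h))

theorem tendsto_iterate_mapG {c μ : ℝ} (hc : 0 ≤ c) (hμ : 1 + c * n ≤ μ)
    {y : Fin n → Fin q → ℝ} (hy : ∀ i, y i ≠ 0) {S S₀ : Matrix (Fin q) (Fin q) ℝ}
    (hS : S.PosDef) (hfix : mapG c y S = S) (hS₀ : S₀ ∈ orderInterval q μ) :
    Tendsto (fun k : ℕ => (mapG c y)^[k] S₀) atTop (𝓝 S) := by
  obtain ⟨g, hiter, hg⟩ := exists_restricted_mapG hc hμ hy
  have := isCompact_iff_compactSpace.1 (isCompact_orderInterval (q := q) μ)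
  have hSmem : S ∈ orderInterval q μ := hfix ▸ mapG_mem_orderInterval hc hμ hy hS
  have h : Tendsto (fun k : ℕ => g^[k] ⟨S₀, hS₀⟩) atTop (𝓝 ⟨S, hSmem⟩) :=
    tendsto_nhds_of_unique_mapClusterPt fun P hP => Subtype.ext
      (eq_of_fixed_mapG hc hy hS hfix (posDef_of_mem_orderInterval P.2) (hg _ P hP))
  exact ((continuous_subtype_val.tendsto _).comp h).congr fun k => hiter k _

end EllipticalGamma

/-! ### Reduction of the log-likelihood to the objective. -/

namespace EllipticalGamma
open Matrix

variable {q n : ℕ}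

theorem cPrime_nonneg {a : ℝ} (ha : (q : ℝ) / 2 < a) : 0 ≤ cPrime q n a :=
  div_nonneg (mul_nonneg zero_le_two (sub_nonneg.2 ha.le)) n.cast_nonneg

theorem posDef_matB {x : Fin n → Fin q → ℝ} {b : ℝ} (hb : 0 < b)
    (hspan : Submodule.span ℝ (Set.range x) = ⊤) : (matB x b).PosDef := by
  have hpsd : ∀ i, (vecMulVec (x i) (x i)).PosSemidef := fun i => by
    simpa using posSemidef_vecMulVec_self_star (x i)
  refine PosDef.of_dotProduct_mulVec_pos ?_ fun v hv => ?_
  · exact ((posSemidef_sum _ fun i _ => hpsd i).smul (by positivity)).isHermitian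
  · have hform : star v ⬝ᵥ matB x b *ᵥ v = 2 / (b * n) * ∑ i, (x i ⬝ᵥ v) ^ 2 := by
      rw [star_trivial, matB, smul_mulVec, dotProduct_smul, sum_mulVec, dotProduct_sum, smul_eq_mul]
      congr 1
      refine Finset.sum_congr rfl fun i _ => ?_
      rw [vecMulVec_mulVec, op_smul_eq_smul, dotProduct_smul, smul_eq_mul, dotProduct_comm v,
        pow_two]
    obtain ⟨i, hi⟩ : ∃ i, x i ⬝ᵥ v ≠ 0 := by
      by_contra! h
      refine hv (dotProduct_self_eq_zero.1 ?_)
      have hmem : v ∈ Submodule.span ℝ (Set.range x) := hspan ▸ Submodule.mem_top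
      have : ∀ w ∈ Submodule.span ℝ (Set.range x), w ⬝ᵥ v = 0 := by
        intro w hw
        induction hw using Submodule.span_induction with
        | mem w hw => obtain ⟨i, rfl⟩ := hw; exact h i
        | zero => exact zero_dotProduct v
        | add w z _ _ h1 h2 => rw [add_dotProduct, h1, h2, add_zero]
        | smul t w _ h1 => rw [smul_dotProduct, h1, smul_zero]
      exact this v hmem
    have hn : 0 < (n : ℝ) := Nat.cast_pos.2 i.pos
    rw [hform]
    exact mul_pos (by positivity) (Finset.sum_pos' (fun _ _ => sq_nonneg _)
      ⟨i, Finset.mem_univ i, by positivity⟩)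

theorem transformed_ne_zero {x : Fin n → Fin q → ℝ} {b : ℝ} (hB : (matB x b).PosDef)
    (hx : ∀ i, x i ≠ 0) (i : Fin n) : transformed x b i ≠ 0 := by
  intro h
  apply hx i
  have hu := (isUnit_iff_isUnit_det _).1 (posDef_sqrt hB).isUnit
  rw [← one_mulVec (x i), ← mul_nonsing_inv _ hu, ← mulVec_mulVec]
  unfold transformed at h
  rw [h, mulVec_zero]

/-- The transformation by `B^(-1/2)` whitens the samples, `∑ yᵢyᵢᵀ = (b n / 2) I`, so the
exponential terms of the likelihood become a multiple of the trace. -/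
theorem sum_transformed_quadratic {x : Fin n → Fin q → ℝ} {b : ℝ} (hB : (matB x b).PosDef)
    (hb : b ≠ 0) (hn : (n : ℝ) ≠ 0) (R : Matrix (Fin q) (Fin q) ℝ) :
    b⁻¹ * ∑ i, transformed x b i ⬝ᵥ R *ᵥ transformed x b i = n / 2 * R.trace := by
  have hu := (isUnit_iff_isUnit_det _).1 (posDef_sqrt hB).isUnit
  have hsum : ∑ i, vecMulVec (transformed x b i) (transformed x b i) =
      (b * n / 2) • (1 : Matrix (Fin q) (Fin q) ℝ) := by
    have h1 : ∀ i, vecMulVec (transformed x b i) (transformed x b i) =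
        (CFC.sqrt (matB x b))⁻¹ * vecMulVec (x i) (x i) * (CFC.sqrt (matB x b))⁻¹ := by
      intro i
      rw [mul_vecMulVec, vecMulVec_mul, ← mulVec_transpose, transpose_nonsing_inv, transpose_sqrt]
      rfl
    have h2 : ∑ i, vecMulVec (x i) (x i) = (b * n / 2) • matB x b := by
      rw [matB, smul_smul, show b * n / 2 * (2 / (b * n)) = 1 by field_simp, one_smul]
    simp only [h1]
    rw [← Finset.sum_mul, ← Finset.mul_sum, h2, mul_smul_comm, smul_mul_assoc]
    congr 1
    nth_rw 2 [← sqrt_mul_sqrt hB]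
    rw [← Matrix.mul_assoc, nonsing_inv_mul _ hu, Matrix.one_mul, mul_nonsing_inv _ hu]
  simp only [← trace_mul_vecMulVec_self]
  rw [← trace_sum, ← Finset.mul_sum, hsum, mul_smul_comm, trace_smul, Matrix.mul_one, smul_eq_mul]
  field_simp

theorem log_density {a b : ℝ} (ha : 0 < a) (hb : 0 < b) (hq : 0 < q)
    {Sig : Matrix (Fin q) (Fin q) ℝ} (hSig : Sig.PosDef) {x : Fin q → ℝ} (hx : x ≠ 0) :
    Real.log (density Sig a b x) =
      Real.log (Real.Gamma ((q : ℝ) / 2) / (Real.pi ^ ((q : ℝ) / 2) * Real.Gamma a * b ^ a))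
        - 1 / 2 * Real.log Sig.det + (a - (q : ℝ) / 2) * Real.log (x ⬝ᵥ Sig⁻¹ *ᵥ x)
        - b⁻¹ * (x ⬝ᵥ Sig⁻¹ *ᵥ x) := by
  have hr : 0 < x ⬝ᵥ Sig⁻¹ *ᵥ x := by simpa using hSig.inv.dotProduct_mulVec_pos hx
  have hdet := hSig.det_pos
  have hq' : (0 : ℝ) < q := Nat.cast_pos.2 hq
  have h1 : 0 < Real.Gamma ((q : ℝ) / 2) := Real.Gamma_pos_of_pos (by positivity)
  have h2 : 0 < Real.Gamma a := Real.Gamma_pos_of_pos ha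
  have h3 : 0 < Real.pi ^ ((q : ℝ) / 2) := Real.rpow_pos_of_pos Real.pi_pos _
  have h4 : 0 < b ^ a := Real.rpow_pos_of_pos hb _
  have h5 : 0 < Sig.det ^ (1 / 2 : ℝ) := Real.rpow_pos_of_pos hdet _
  have h6 : 0 < (x ⬝ᵥ Sig⁻¹ *ᵥ x) ^ (a - (q : ℝ) / 2) := Real.rpow_pos_of_pos hr _
  unfold density
  rw [Real.log_mul (by positivity) (Real.exp_pos _).ne', Real.log_mul (by positivity) h6.ne',
    Real.log_exp, Real.log_rpow hr, ← div_div, Real.log_div (by positivity) h5.ne',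
    Real.log_rpow hdet]
  ring

theorem exists_logLikelihood_eq {x : Fin n → Fin q → ℝ} {a b : ℝ} (hx : ∀ i, x i ≠ 0)
    (hB : (matB x b).PosDef) (ha : 0 < a) (hb : 0 < b) (hq : 0 < q) (hn : 0 < n) :
    ∃ K : ℝ, ∀ Sig : Matrix (Fin q) (Fin q) ℝ, Sig.PosDef → logLikelihood x a b Sig =
      K + n / 2 * objective (cPrime q n a) (transformed x b)
        (CFC.sqrt (matB x b) * Sig⁻¹ * CFC.sqrt (matB x b)) := by
  -- `K` collects the normalizing constants and the term in `log det B` produced by replacing `Sig`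
  -- with `R`.
  refine ⟨n * Real.log (Real.Gamma ((q : ℝ) / 2) /
    (Real.pi ^ ((q : ℝ) / 2) * Real.Gamma a * b ^ a)) - n / 2 * Real.log (matB x b).det,
    fun Sig hSig => ?_⟩
  have hn' : (n : ℝ) ≠ 0 := Nat.cast_ne_zero.2 hn.ne'
  have hu := (isUnit_iff_isUnit_det _).1 (posDef_sqrt hB).isUnit
  obtain ⟨R, hR⟩ : ∃ R, R = CFC.sqrt (matB x b) * Sig⁻¹ * CFC.sqrt (matB x b) := ⟨_, rfl⟩
  have hquad : ∀ i, x i ⬝ᵥ Sig⁻¹ *ᵥ x i = transformed x b i ⬝ᵥ R *ᵥ transformed x b i := by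
    intro i
    have hi : CFC.sqrt (matB x b) *ᵥ transformed x b i = x i := by
      unfold transformed
      rw [mulVec_mulVec, mul_nonsing_inv _ hu, one_mulVec]
    rw [hR, ← mulVec_mulVec, ← mulVec_mulVec, dotProduct_mulVec (transformed x b i), ← mulVec_transpose,
      transpose_sqrt, hi]
  have hdet : Real.log R.det = Real.log (matB x b).det - Real.log Sig.det := by
    rw [hR, det_mul, det_mul, mul_right_comm, ← det_mul, sqrt_mul_sqrt hB,
      Real.log_mul hB.det_pos.ne' hSig.inv.det_pos.ne', det_nonsing_inv, Ring.inverse_eq_inv',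
      Real.log_inv, sub_eq_add_neg]
  rw [← hR]
  have htrace := sum_transformed_quadratic hB hb.ne' hn' R
  unfold logLikelihood objective
  simp only [log_density ha hb hq hSig (hx _), hquad]
  rw [Finset.sum_sub_distrib, Finset.sum_add_distrib, ← Finset.mul_sum, ← Finset.mul_sum, htrace,
    Finset.sum_const, Finset.card_univ, Fintype.card_fin, nsmul_eq_mul, hdet, cPrime]
  field_simp
  ring

theorem logLikelihood_lt {x : Fin n → Fin q → ℝ} {a b : ℝ} (hx : ∀ i, x i ≠ 0)
    (hspan : Submodule.span ℝ (Set.range x) = ⊤) (ha : (q : ℝ) / 2 < a) (hb : 0 < b)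
    {S Sig : Matrix (Fin q) (Fin q) ℝ} (hS : S.PosDef)
    (hfix : mapG (cPrime q n a) (transformed x b) S = S) (hSig : Sig.PosDef)
    (hne : Sig ≠ CFC.sqrt (matB x b) * S⁻¹ * CFC.sqrt (matB x b)) :
    logLikelihood x a b Sig <
      logLikelihood x a b (CFC.sqrt (matB x b) * S⁻¹ * CFC.sqrt (matB x b)) := by
  have hB := posDef_matB hb hspan
  -- Positivity of `q` is needed for the logarithm of the normalizing factor, as `Real.Gamma 0 = 0`.
  -- For `q = 0` there is only one matrix, against `hne`.
  have hq : 0 < q := by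
    rcases Nat.eq_zero_or_pos q with rfl | h
    · exact absurd (Subsingleton.elim _ _) hne
    · exact h
  have hn : 0 < n := by
    rcases Nat.eq_zero_or_pos n with rfl | h
    · have : Nonempty (Fin q) := ⟨⟨0, hq⟩⟩
      rw [Set.range_eq_empty, Submodule.span_empty] at hspan
      exact absurd hspan bot_ne_top
    · exact h
  have huS := (isUnit_iff_isUnit_det _).1 hS.isUnit
  have huSig := (isUnit_iff_isUnit_det _).1 hSig.isUnit
  have hH := posDef_sqrt hB
  -- The substitution `S ↦ B^(1/2) S⁻¹ B^(1/2)` is an involution, so the strict maximizer of the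
  -- objective transfers to the likelihood.
  have hinv : CFC.sqrt (matB x b) * (CFC.sqrt (matB x b) * S⁻¹ * CFC.sqrt (matB x b))⁻¹ *
      CFC.sqrt (matB x b) = S := by
    rw [Matrix.mul_inv_rev, Matrix.mul_inv_rev, nonsing_inv_nonsing_inv _ huS,
      ← Matrix.mul_assoc (CFC.sqrt _)⁻¹, conj_sqrt_inv hB]
  have hne' : CFC.sqrt (matB x b) * Sig⁻¹ * CFC.sqrt (matB x b) ≠ S := by
    intro h
    apply hne
    rw [← h, Matrix.mul_inv_rev, Matrix.mul_inv_rev, nonsing_inv_nonsing_inv _ huSig,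
      ← Matrix.mul_assoc (CFC.sqrt _)⁻¹, conj_sqrt_inv hB]
  obtain ⟨K, hK⟩ := exists_logLikelihood_eq hx hB
    ((div_nonneg q.cast_nonneg zero_le_two).trans_lt ha) hb hq hn
  rw [hK _ hSig, hK _ (posDef_conj hH hS.inv), hinv]
  have := objective_lt_of_fixed (cPrime_nonneg ha) (transformed_ne_zero hB hx) hS hfix
    (posDef_conj hH hSig.inv) hne'
  have hn' : (0 : ℝ) < n := Nat.cast_pos.2 hn
  gcongr

end EllipticalGamma

theorem theorem2 (q n : ℕ) (x : Fin n → Fin q → ℝ)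
    (hx : ∀ i, x i ≠ 0) (hspan : Submodule.span ℝ (Set.range x) = ⊤)
    (a b : ℝ) (ha : (q : ℝ) / 2 < a) (hb : 0 < b) :
    ∃ Sstar : Matrix (Fin q) (Fin q) ℝ,
      Sstar.PosDef ∧
      EllipticalGamma.mapG (EllipticalGamma.cPrime q n a)
        (EllipticalGamma.transformed x b) Sstar = Sstar ∧
      (∀ T : Matrix (Fin q) (Fin q) ℝ, T.PosDef →
        EllipticalGamma.mapG (EllipticalGamma.cPrime q n a)
          (EllipticalGamma.transformed x b) T = T → T = Sstar) ∧
      (∀ μ : ℝ, 1 + EllipticalGamma.cPrime q n a * (n : ℝ) < μ →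
        IsCompact (EllipticalGamma.orderInterval q μ) ∧
        Sstar ∈ EllipticalGamma.orderInterval q μ ∧
        ∀ S₀ ∈ EllipticalGamma.orderInterval q μ,
          Filter.Tendsto
            (fun k : ℕ => (EllipticalGamma.mapG (EllipticalGamma.cPrime q n a)
              (EllipticalGamma.transformed x b))^[k] S₀)
            Filter.atTop (nhds Sstar)) ∧
      (CFC.sqrt (EllipticalGamma.matB x b) * Sstar⁻¹ *
        CFC.sqrt (EllipticalGamma.matB x b)).PosDef ∧
      (∀ Sig : Matrix (Fin q) (Fin q) ℝ, Sig.PosDef →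
        Sig ≠ CFC.sqrt (EllipticalGamma.matB x b) * Sstar⁻¹ *
          CFC.sqrt (EllipticalGamma.matB x b) →
        EllipticalGamma.logLikelihood x a b Sig <
          EllipticalGamma.logLikelihood x a b
            (CFC.sqrt (EllipticalGamma.matB x b) * Sstar⁻¹ *
              CFC.sqrt (EllipticalGamma.matB x b))) := by
  have hB := EllipticalGamma.posDef_matB hb hspan
  have hc := EllipticalGamma.cPrime_nonneg (n := n) ha
  have hy := EllipticalGamma.transformed_ne_zero hB hx
  obtain ⟨S, hS, hfix⟩ := EllipticalGamma.exists_fixed_mapG hc hy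
  refine ⟨S, hS, hfix, fun T hT hfT => EllipticalGamma.eq_of_fixed_mapG hc hy hS hfix hT hfT,
    fun μ hμ => ⟨EllipticalGamma.isCompact_orderInterval μ, ?_, fun S₀ hS₀ =>
      EllipticalGamma.tendsto_iterate_mapG hc hμ.le hy hS hfix hS₀⟩,
    EllipticalGamma.posDef_conj (EllipticalGamma.posDef_sqrt hB) hS.inv,
    fun Sig hSig hne => EllipticalGamma.logLikelihood_lt hx hspan ha hb hS hfix hSig hne⟩
  have := EllipticalGamma.mapG_mem_orderInterval hc hμ.le hy hS
  rwa [hfix] at this
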